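/- Let $q$ be a prime power and let $k,n_{\mathrm T},n,x$ be non-negative integers with $k\le n_{\mathrm T}$, $n\le n_{\mathrm T}$ and $x\le k$. The transmitted packets are the $k$ source packets and $n_{\mathrm T}-k$ coded packets. The coding vector of the $i$-th source packet is the unit vector $\mathbf e_i\in\mathbb F_q^k$; the coding vectors of the coded packets are independent and uniformly distributed on $\mathbb F_q^k$. A receiver gets a random set of the transmitted packets, which is independent of the coding coefficients. Let $N$ be the number of received packets, and suppose that $P(N=n)>0$ and that, given $N=n$, all $n$-element sets of transmitted packets are equally likely to be the set of received packets. Let $\mathbf M$ be the matrix whose rows are the coding vectors of the received packets, and let $X=\{i:\mathbf e_i\in\mathrm{Row}(\mathbf M)\}$ be the set of indices of the source packets that can be recovered, where $\mathrm{Row}(\mathbf M)$ is the row space of $\mathbf M$. Then $$ P(|X|\ge x\mid N=n)=\frac{1}{\binom{n_{\mathrm T}}{n}}\sum_{r=x}^{\min(n,k)}\ \sum_{h=h_{\min}}^{r}\Biggl(\binom{k}{h}\binom{n_{\mathrm T}-k}{n-h}\,q^{-(n-h)(k-h)}\prod_{\ell=0}^{r-h-1}\bigl(q^{n-h}-q^{\ell}\bigr)\cdot\sum_{i=x_{\min}}^{r-h}\binom{k-h}{i}\sum_{j=0}^{k-h-i}(-1)^j\binom{k-h-i}{j}\genfrac{[}{]}{0pt}{}{k-h-i-j}{r-h-i-j}_q\Biggr),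 $$ where $h_{\min}=\max(0,\,n-n_{\mathrm T}+k)$, $x_{\min}=\max(0,\,x-h)$, and $\genfrac{[}{]}{0pt}{}{m}{d}_q$ is the Gaussian binomial coefficient, that is, the number of $d$-dimensional subspaces of $\mathbb F_q^m$ (in particular it is $0$ when $d<0$). An empty sum is $0$ and an empty product is $1$. -/

import Mathlib

open MeasureTheory ProbabilityTheory

/-- The Gaussian binomial coefficient `[m, d]_q` for `q = |F|`: the number of `d`-dimensional
subspaces of the `m`-dimensional space `F ^ m`. The lower entry is an integer, so that the
coefficient is zero when `d < 0` (and when `d > m`), there being no such subspace. -/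
noncomputable def gaussBinom (F : Type*) [Field F] (m : ℕ) (d : ℤ) : ℕ :=
  Nat.card {V : Submodule F (Fin m → F) // (Module.finrank F V : ℤ) = d}

/-- The space spanned by the rows of a matrix. -/
def rowSpace {F ι : Type*} [Field F] {k : ℕ} (M : Matrix ι (Fin k) F) :
    Submodule F (Fin k → F) :=
  Submodule.span F (Set.range M.row)

/-- The set `X` of indices `i` for which the unit vector `e_i` lies in the row space of `M`: the
source packets that can be recovered from packets whose coding vectors are the rows of `M`. -/
def recoverable {F ι : Type*} [Field F] {k : ℕ} (M : Matrix ι (Fin k) F) : Set (Fin k) :=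
  {i | (Pi.single i 1 : Fin k → F) ∈ rowSpace M}

/-- The coding vectors of all packets transmitted in systematic network coding: the `k` source
packets, with the unit vectors as coding vectors, and `m` coded packets, whose coding vectors
are the rows of `C`. -/
def transmitted {F : Type*} [Field F] {k m : ℕ} (C : Matrix (Fin m) (Fin k) F) :
    Matrix (Fin k ⊕ Fin m) (Fin k) F :=
  Matrix.fromRows 1 C

/-- The matrix formed by the coding vectors of the received packets, where `S` is the set of
(the labels of) the transmitted packets that are received. -/
def received {F : Type*} [Field F] {k m : ℕ} (C : Matrix (Fin m) (Fin k) F)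
    (S : Finset (Fin k ⊕ Fin m)) : Matrix S (Fin k) F :=
  (transmitted C).submatrix Subtype.val id

/-! ### Unit vectors in a subspace and deletion of coordinates -/

section UnitVectors

variable {F ι : Type*} [Field F]

/-! Since reception is independent of the coding and uniform on `n`-sets, the conditional
probability is an average over received sets `A = H ⊔ T` (`h` source packets, `n - h` coded ones) of
the proportion of coding matrices that recover at least `x` packets (`cond_real_eq_average`). For
fixed `A`, the row space contains `e_i` for `i ∈ H`, so deleting these coordinates loses exactly `h`
recovered packets (`ncard_recoverable_received`). What remains is a uniform `(n - h) × (k - h)`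
matrix. Such matrices are sorted by row space `V`. The number with a given `V` depends only on `s =
dim V` and is the product `∏ (q^(n-h) - q^l)` (`natCard_span_range_eq`). The `s`-dimensional `V`
with exactly `i` unit vectors are counted by inclusion-exclusion
(`natCard_submodule_unitIndices_eq`), because those containing a prescribed set of unit vectors
correspond to subspaces of a quotient. Finally `r = h + s` is the total rank. -/

/-- The projection that deletes the coordinates in `U`. -/
def deleteCoords (F : Type*) [Field F] (U : Finset ι) : (ι → F) →ₗ[F] ({i // i ∉ U} → F) :=
  LinearMap.funLeft F F Subtype.val

theorem deleteCoords_surjective (U : Finset ι) : Function.Surjective (deleteCoords F U) :=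
  LinearMap.funLeft_surjective_of_injective F F _ Subtype.val_injective

theorem mem_ker_deleteCoords {U : Finset ι} {v : ι → F} :
    v ∈ LinearMap.ker (deleteCoords F U) ↔ ∀ i ∉ U, v i = 0 := by
  rw [LinearMap.mem_ker, funext_iff]
  simp [deleteCoords, LinearMap.funLeft]

variable [DecidableEq ι]

/-- The indices of the unit vectors that lie in a subspace of `ι → F`. -/
def unitIndices (V : Submodule F (ι → F)) : Set ι :=
  {i | (Pi.single i 1 : ι → F) ∈ V}

theorem deleteCoords_single (U : Finset ι) (i : {i // i ∉ U}) :
    deleteCoords F U (Pi.single i.1 1) = Pi.single i 1 := by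
  ext j
  simp only [deleteCoords, LinearMap.funLeft_apply, Pi.single_apply, Subtype.ext_iff]

/-- The kernel is spanned by the unit vectors indexed by `U`. -/
theorem ker_deleteCoords_le_iff [Fintype ι] {U : Finset ι} {V : Submodule F (ι → F)} :
    LinearMap.ker (deleteCoords F U) ≤ V ↔ (U : Set ι) ⊆ unitIndices V := by
  constructor
  · intro h i hi
    refine h (mem_ker_deleteCoords.2 fun j hj => Pi.single_eq_of_ne ?_ _)
    rintro rfl
    exact hj hi
  · intro h v hv
    rw [mem_ker_deleteCoords] at hv
    rw [← Finset.univ_sum_single v]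
    refine Submodule.sum_mem _ fun i _ => ?_
    by_cases hi : i ∈ U
    · have := V.smul_mem (v i) (h hi)
      rwa [← Pi.single_smul', smul_eq_mul, mul_one] at this
    · rw [hv i hi, Pi.single_zero]
      exact V.zero_mem

theorem mem_unitIndices_map_deleteCoords {U : Finset ι} {V : Submodule F (ι → F)}
    (h : LinearMap.ker (deleteCoords F U) ≤ V) (i : {i // i ∉ U}) :
    i ∈ unitIndices (V.map (deleteCoords F U)) ↔ i.1 ∈ unitIndices V := by
  simp only [unitIndices, Set.mem_ofPred_eq, ← deleteCoords_single]
  rw [← Submodule.mem_comap, Submodule.comap_map_eq, sup_of_le_left h]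

theorem ncard_unitIndices_eq_add [Fintype ι] {U : Finset ι} {V : Submodule F (ι → F)}
    (h : (U : Set ι) ⊆ unitIndices V) :
    (unitIndices V).ncard = U.card + (unitIndices (V.map (deleteCoords F U))).ncard := by
  have key : unitIndices V = (U : Set ι) ∪
      Subtype.val '' unitIndices (V.map (deleteCoords F U)) := by
    ext i
    simp only [Set.mem_union, Set.mem_image, Subtype.exists, exists_and_right, exists_eq_right,
      mem_unitIndices_map_deleteCoords (ker_deleteCoords_le_iff.2 h)]
    by_cases hi : i ∈ U
    · simpa [hi] using h hi
    · simp [hi]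
  rw [key, Set.ncard_union_eq, Set.ncard_coe_finset, Set.ncard_image_of_injective _
    Subtype.val_injective]
  rw [Set.disjoint_left]
  rintro i hi ⟨j, -, rfl⟩
  exact j.2 hi

theorem finrank_ker_deleteCoords [Fintype ι] (U : Finset ι) :
    Module.finrank F (LinearMap.ker (deleteCoords F U)) = U.card := by
  have h := LinearMap.finrank_range_add_finrank_ker (deleteCoords F U)
  rw [LinearMap.range_eq_top.2 (deleteCoords_surjective U), finrank_top,
    Module.finrank_fintype_fun_eq_card, Module.finrank_fintype_fun_eq_card] at h
  have h2 := Fintype.card_subtype_compl (fun i => i ∈ U)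
  rw [Fintype.card_coe] at h2
  have := U.card_le_univ
  omega

theorem finrank_eq_map_deleteCoords_add [Fintype ι] {U : Finset ι} {V : Submodule F (ι → F)}
    (h : LinearMap.ker (deleteCoords F U) ≤ V) :
    Module.finrank F V = Module.finrank F (V.map (deleteCoords F U)) + U.card := by
  rw [← LinearMap.finrank_range_add_finrank_ker ((deleteCoords F U).domRestrict V),
    LinearMap.range_domRestrict, LinearMap.ker_domRestrict,
    (Submodule.comapSubtypeEquivOfLe h).finrank_eq, finrank_ker_deleteCoords]

end UnitVectors

/-! ### Counting subspaces by their unit vectors -/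

section SubspaceCount

variable {F ι : Type*} [Field F] [Fintype ι]

theorem natCard_submodule_finrank_eq (d : ℤ) :
    Nat.card {V : Submodule F (ι → F) // (Module.finrank F V : ℤ) = d} =
      gaussBinom F (Fintype.card ι) d := by
  obtain ⟨e⟩ : Nonempty ((ι → F) ≃ₗ[F] (Fin (Fintype.card ι) → F)) :=
    ⟨LinearEquiv.funCongrLeft F F (Fintype.equivFin ι).symm⟩
  have h : ∀ V : Submodule F (ι → F),
      Module.finrank F (Submodule.orderIsoMapComap e V) = Module.finrank F V :=
    fun V => LinearEquiv.finrank_map_eq e V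
  refine Nat.card_congr ((Submodule.orderIsoMapComap e).toEquiv.subtypeEquiv fun V => ?_)
  rw [← h V, RelIso.coe_fn_toEquiv]

variable [DecidableEq ι]

/-- Correspondence theorem for the projection deleting `U`, whose kernel has dimension `|U|`. With
integer `s`, the case `|U| > s` needs no separate treatment: both sides are zero. -/
theorem natCard_submodule_subset_unitIndices (U : Finset ι) (s : ℤ) :
    Nat.card {V : Submodule F (ι → F) //
        (Module.finrank F V : ℤ) = s ∧ (U : Set ι) ⊆ unitIndices V} =
      gaussBinom F (Fintype.card ι - U.card) (s - U.card) := by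
  have hc : Fintype.card {i // i ∉ U} = Fintype.card ι - U.card := by
    rw [Fintype.card_subtype_compl (fun i => i ∈ U), Fintype.card_coe]
  rw [← hc, ← natCard_submodule_finrank_eq]
  refine Nat.card_congr
    { toFun := fun V => ⟨V.1.map (deleteCoords F U), ?_⟩
      invFun := fun W => ⟨W.1.comap (deleteCoords F U), ?_, ?_⟩
      left_inv := ?_
      right_inv := ?_ }
  · have := finrank_eq_map_deleteCoords_add (ker_deleteCoords_le_iff.2 V.2.2)
    have := V.2.1
    omega
  · have := finrank_eq_map_deleteCoords_add (F := F) (U := U)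
      (LinearMap.ker_le_comap (p := W.1) (deleteCoords F U))
    rw [Submodule.map_comap_eq_of_surjective (deleteCoords_surjective U)] at this
    have := W.2
    omega
  · exact ker_deleteCoords_le_iff.1 (LinearMap.ker_le_comap _)
  · rintro ⟨V, h1, h2⟩
    ext1
    simp only [Submodule.comap_map_eq, sup_of_le_left (ker_deleteCoords_le_iff.2 h2)]
  · rintro ⟨W, h⟩
    ext1
    simp only [Submodule.map_comap_eq_of_surjective (deleteCoords_surjective U)]

/-- If `I ⊆ X`, only `J ⊆ X \ I` contribute, and their alternating sum vanishes unless `X \ I` is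
empty. -/
theorem sum_neg_one_pow_subset_eq_ite {R : Type*} [CommRing R] (I X : Finset ι) :
    ∑ J ∈ Iᶜ.powerset, (-1 : R) ^ J.card * (if I ∪ J ⊆ X then 1 else 0) =
      if X = I then 1 else 0 := by
  by_cases hI : I ⊆ X
  · have h1 : ∑ J ∈ Iᶜ.powerset, (-1 : R) ^ J.card * (if I ∪ J ⊆ X then 1 else 0) =
        ∑ J ∈ (X \ I).powerset, (-1 : R) ^ J.card := by
      simp only [mul_ite, mul_one, mul_zero]
      rw [← Finset.sum_filter]
      refine Finset.sum_congr ?_ fun _ _ => rfl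
      ext J
      simp only [Finset.mem_filter, Finset.mem_powerset, Finset.union_subset_iff, hI, true_and,
        Finset.subset_sdiff, Finset.subset_compl_iff_disjoint_right, and_comm]
    have h2 := congrArg (Int.cast : ℤ → R) (Finset.sum_powerset_neg_one_pow_card (x := X \ I))
    push_cast at h2
    rw [h1, h2]
    refine if_congr ?_ rfl rfl
    rw [Finset.sdiff_eq_empty_iff_subset]
    exact ⟨fun h => h.antisymm hI, fun h => h.le⟩
  · rw [if_neg (fun h => hI h.ge)]
    refine Finset.sum_eq_zero fun J _ => ?_
    rw [if_neg (fun h => hI (Finset.union_subset_left h)), mul_zero]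

theorem ncard_unitIndices_le_finrank (V : Submodule F (ι → F)) :
    (unitIndices V).ncard ≤ Module.finrank F V := by
  classical
  have h := finrank_eq_map_deleteCoords_add (F := F) (U := (unitIndices V).toFinset) (V := V)
    (ker_deleteCoords_le_iff.2 (Set.coe_toFinset _).le)
  rw [Set.ncard_eq_toFinset_card']
  omega

variable [Finite F]

/-- Inclusion-exclusion over the sets `J` of further unit vectors; each term depends only on `|J|`.
-/
theorem natCard_submodule_unitIndices_eq (I : Finset ι) (s : ℤ) :
    (Nat.card {V : Submodule F (ι → F) //
        (Module.finrank F V : ℤ) = s ∧ unitIndices V = (I : Set ι)} : ℝ) =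
      ∑ j ∈ Finset.range (Fintype.card ι - I.card + 1),
        (-1 : ℝ) ^ j * ((Fintype.card ι - I.card).choose j : ℝ) *
          (gaussBinom F (Fintype.card ι - I.card - j) (s - I.card - j) : ℝ) := by
  classical
  let _ : Fintype (Submodule F (ι → F)) := Fintype.ofFinite _
  have hcount : ∀ P : Submodule F (ι → F) → Prop,
      (Nat.card {V : Submodule F (ι → F) // (Module.finrank F V : ℤ) = s ∧ P V} : ℝ) =
        ∑ V ∈ {V : Submodule F (ι → F) | (Module.finrank F V : ℤ) = s}, if P V then 1 else 0 := by
    intro P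
    rw [Nat.card_eq_fintype_card, Fintype.card_subtype, Finset.sum_boole, Finset.filter_filter]
  have hf : ∀ V : Submodule F (ι → F), ((unitIndices V).toFinset : Set ι) = unitIndices V :=
    fun V => Set.coe_toFinset _
  rw [hcount]
  calc _ = ∑ V ∈ {V : Submodule F (ι → F) | (Module.finrank F V : ℤ) = s},
        ∑ J ∈ Iᶜ.powerset, (-1 : ℝ) ^ J.card *
          (if ((I ∪ J : Finset ι) : Set ι) ⊆ unitIndices V then 1 else 0) := by
        refine Finset.sum_congr rfl fun V _ => ?_
        rw [← hf V]
        simp only [Finset.coe_inj, Finset.coe_subset]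
        exact (sum_neg_one_pow_subset_eq_ite _ _).symm
    _ = ∑ J ∈ Iᶜ.powerset, (-1 : ℝ) ^ J.card *
          (gaussBinom F (Fintype.card ι - I.card - J.card) (s - I.card - J.card) : ℝ) := by
        rw [Finset.sum_comm]
        refine Finset.sum_congr rfl fun J hJ => ?_
        rw [← Finset.mul_sum, ← hcount, natCard_submodule_subset_unitIndices,
          Finset.card_union_of_disjoint
            (Finset.subset_compl_iff_disjoint_left.1 (Finset.mem_powerset.1 hJ)),
          Nat.sub_sub, Nat.cast_add, sub_sub]
    _ = _ := by
        rw [Finset.sum_powerset_apply_card (fun j => (-1 : ℝ) ^ j *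
          (gaussBinom F (Fintype.card ι - I.card - j) (s - I.card - j) : ℝ)), Finset.card_compl]
        refine Finset.sum_congr rfl fun j _ => ?_
        rw [nsmul_eq_mul]
        ring

theorem natCard_submodule_le_ncard_unitIndices (s y : ℕ) :
    (Nat.card {V : Submodule F (ι → F) //
        Module.finrank F V = s ∧ y ≤ (unitIndices V).ncard} : ℝ) =
      ∑ i ∈ Finset.Icc y s, ((Fintype.card ι).choose i : ℝ) *
        ∑ j ∈ Finset.range (Fintype.card ι - i + 1),
          (-1 : ℝ) ^ j * ((Fintype.card ι - i).choose j : ℝ) *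
            (gaussBinom F (Fintype.card ι - i - j) ((s : ℤ) - i - j) : ℝ) := by
  classical
  let _ : Fintype (Submodule F (ι → F)) := Fintype.ofFinite _
  have h1 : Nat.card {V : Submodule F (ι → F) //
        Module.finrank F V = s ∧ y ≤ (unitIndices V).ncard} =
      ∑ i ∈ Finset.Icc y s, ∑ I ∈ Finset.powersetCard i (Finset.univ : Finset ι),
        Nat.card {V : Submodule F (ι → F) //
          (Module.finrank F V : ℤ) = s ∧ unitIndices V = (I : Set ι)} := by
    simp only [Nat.card_eq_fintype_card, Fintype.card_subtype, Nat.cast_inj]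
    rw [Finset.card_eq_sum_card_fiberwise (t := Finset.Icc y s)
      (f := fun V => (unitIndices V).ncard)]
    · refine Finset.sum_congr rfl fun i hi => ?_
      rw [Finset.card_eq_sum_card_fiberwise (t := Finset.powersetCard i (Finset.univ : Finset ι))
        (f := fun V => (unitIndices V).toFinset)]
      · refine Finset.sum_congr rfl fun I hI => ?_
        congr 1
        ext V
        have hI' := (Finset.mem_powersetCard.1 hI).2
        have hi' := (Finset.mem_Icc.1 hi).1
        have hiff : (unitIndices V).toFinset = I ↔ unitIndices V = (I : Set ι) := by
          rw [← Finset.coe_inj, Set.coe_toFinset]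
        simp only [Finset.mem_filter, Finset.mem_univ, true_and, hiff]
        constructor
        · tauto
        · rintro ⟨h1, h2⟩
          rw [h2, Set.ncard_coe_finset, hI']
          exact ⟨⟨⟨h1, hi'⟩, rfl⟩, rfl⟩
      · intro V hV
        simp only [Finset.coe_filter, Finset.mem_filter, Finset.mem_univ, true_and,
          Set.mem_ofPred_eq] at hV
        exact Finset.mem_powersetCard.2
          ⟨Finset.subset_univ _, by rw [← Set.ncard_eq_toFinset_card', hV.2]⟩
    · intro V hV
      simp only [Finset.coe_filter, Finset.mem_univ, true_and, Set.mem_ofPred_eq] at hV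
      simpa [hV.2, ← hV.1] using ncard_unitIndices_le_finrank V
  rw [h1]
  push_cast
  refine Finset.sum_congr rfl fun i _ => ?_
  rw [Finset.sum_congr rfl fun I hI => by
    rw [natCard_submodule_unitIndices_eq, (Finset.mem_powersetCard.1 hI).2]]
  rw [Finset.sum_const, Finset.card_powersetCard, Finset.card_univ, nsmul_eq_mul]

end SubspaceCount

/-! ### Counting matrices by row space -/

section SpanningFamilies

variable {F α ι : Type*} [Field F] [Fintype F] [Fintype α]

theorem natCard_span_range_eq_top {V : Type*} [AddCommGroup V] [Module F V] [FiniteDimensional F V] :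
    (Nat.card {f : α → V // Submodule.span F (Set.range f) = ⊤} : ℝ) =
      ∏ l ∈ Finset.range (Module.finrank F V),
        ((Fintype.card F : ℝ) ^ Fintype.card α - (Fintype.card F : ℝ) ^ l) := by
  classical
  obtain ⟨s, hs⟩ : ∃ s, s = Module.finrank F V := ⟨_, rfl⟩
  rw [← hs]
  let e : V ≃ₗ[F] (Fin s → F) := LinearEquiv.ofFinrankEq _ _ (by simp [hs])
  have hcard : Nat.card {f : α → V // Submodule.span F (Set.range f) = ⊤} =
      Nat.card {g : Fin s → α → F // LinearIndependent F g} := by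
    refine Nat.card_congr (((Equiv.piCongrRight fun _ : α => e.toEquiv).trans
      (Equiv.piComm fun _ _ => F)).subtypeEquiv fun f => ?_)
    -- Row rank equals column rank: the rows of `A` span `F^s` iff its `s` columns are independent,
    -- and independent families have a known count.
    let A : Matrix α (Fin s) F := Matrix.of fun a => e (f a)
    change _ ↔ LinearIndependent F A.transpose.row
    have h1 : Submodule.span F (Set.range A.row) =
        (Submodule.span F (Set.range f)).map (e : V →ₗ[F] (Fin s → F)) := by
      rw [Submodule.map_span, ← Set.range_comp]
      rfl
    rw [linearIndependent_iff_card_eq_finrank_span, Set.finrank, ← Matrix.rank_eq_finrank_span_row,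
      Matrix.rank_transpose, Matrix.rank_eq_finrank_span_row, h1, LinearEquiv.finrank_map_eq,
      Fintype.card_fin, hs]
    exact ⟨fun h => by rw [h, finrank_top], fun h => Submodule.eq_top_of_finrank_eq h.symm⟩
  rw [hcard]
  by_cases h : s ≤ Fintype.card α
  · rw [card_linearIndependent (by simpa using h), Module.finrank_fintype_fun_eq_card,
      Fin.prod_univ_eq_prod_range (fun i => Fintype.card F ^ Fintype.card α - Fintype.card F ^ i),
      Nat.cast_prod]
    refine Finset.prod_congr rfl fun l hl => ?_
    rw [Nat.cast_sub (Nat.pow_le_pow_right Fintype.card_pos ((Finset.mem_range.1 hl).le.trans h))]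
    push_cast
    rfl
  -- Too few vectors to span: the factor at `l = |α|` is zero.
  · rw [Finset.prod_eq_zero (Finset.mem_range.2 (not_le.1 h)) (sub_self _), Nat.cast_eq_zero]
    refine Nat.card_eq_zero.2 (Or.inl ⟨fun g => h ?_⟩)
    simpa using g.2.fintype_card_le_finrank

theorem natCard_span_range_eq [Fintype ι] (V : Submodule F (ι → F)) :
    (Nat.card {D : α → ι → F // Submodule.span F (Set.range D) = V} : ℝ) =
      ∏ l ∈ Finset.range (Module.finrank F V),
        ((Fintype.card F : ℝ) ^ Fintype.card α - (Fintype.card F : ℝ) ^ l) := by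
  rw [← natCard_span_range_eq_top (α := α) (V := V)]
  have key : ∀ f : α → V, Submodule.span F (Set.range fun a => (f a : ι → F)) =
      (Submodule.span F (Set.range f)).map V.subtype := by
    intro f
    rw [Submodule.map_span, ← Set.range_comp]
    rfl
  congr 1
  refine Nat.card_congr
    { toFun := fun D => ⟨fun a => ⟨D.1 a, D.2.le (Submodule.subset_span ⟨a, rfl⟩)⟩, ?_⟩
      invFun := fun f => ⟨fun a => f.1 a, ?_⟩
      left_inv := fun D => rfl
      right_inv := fun f => rfl }
  · apply Submodule.map_injective_of_injective V.injective_subtype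
    rw [← key, Submodule.map_subtype_top]
    exact D.2
  · rw [key, f.2, Submodule.map_subtype_top]

theorem natCard_le_ncard_unitIndices_span_range [Fintype ι] [DecidableEq ι] (y : ℕ) :
    (Nat.card {D : α → ι → F //
        y ≤ (unitIndices (Submodule.span F (Set.range D))).ncard} : ℝ) =
      ∑ s ∈ Finset.range (Fintype.card ι + 1),
        (∏ l ∈ Finset.range s,
          ((Fintype.card F : ℝ) ^ Fintype.card α - (Fintype.card F : ℝ) ^ l)) *
        ∑ i ∈ Finset.Icc y s, ((Fintype.card ι).choose i : ℝ) *
          ∑ j ∈ Finset.range (Fintype.card ι - i + 1),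
            (-1 : ℝ) ^ j * ((Fintype.card ι - i).choose j : ℝ) *
              (gaussBinom F (Fintype.card ι - i - j) ((s : ℤ) - i - j) : ℝ) := by
  classical
  let _ : Fintype (Submodule F (ι → F)) := Fintype.ofFinite _
  have h1 : Nat.card {D : α → ι → F //
        y ≤ (unitIndices (Submodule.span F (Set.range D))).ncard} =
      ∑ s ∈ Finset.range (Fintype.card ι + 1),
        ∑ V ∈ {V : Submodule F (ι → F) | Module.finrank F V = s ∧ y ≤ (unitIndices V).ncard},
          Nat.card {D : α → ι → F // Submodule.span F (Set.range D) = V} := by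
    simp only [Nat.card_eq_fintype_card, Fintype.card_subtype]
    rw [Finset.card_eq_sum_card_fiberwise (t := Finset.range (Fintype.card ι + 1))
      (f := fun D => Module.finrank F (Submodule.span F (Set.range D)))]
    · refine Finset.sum_congr rfl fun s _ => ?_
      rw [Finset.card_eq_sum_card_fiberwise
        (t := {V : Submodule F (ι → F) | Module.finrank F V = s ∧ y ≤ (unitIndices V).ncard})
        (f := fun D => Submodule.span F (Set.range D))]
      · refine Finset.sum_congr rfl fun V hV => ?_
        congr 1
        ext D
        simp only [Finset.mem_filter, Finset.mem_univ, true_and] at hV ⊢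
        constructor
        · tauto
        · rintro rfl
          exact ⟨⟨hV.2, hV.1⟩, rfl⟩
      · intro D hD
        simp only [Finset.coe_filter, Finset.mem_filter, Finset.mem_univ, true_and,
          Set.mem_ofPred_eq] at hD ⊢
        exact hD.symm
    · intro D _
      have := Submodule.finrank_le (Submodule.span F (Set.range D))
      rw [Module.finrank_fintype_fun_eq_card] at this
      exact Finset.mem_coe.2 (Finset.mem_range_succ_iff.2 this)
  rw [h1]
  push_cast
  refine Finset.sum_congr rfl fun s _ => ?_
  rw [← natCard_submodule_le_ncard_unitIndices, Nat.card_eq_fintype_card, Fintype.card_subtype,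
    mul_comm, ← nsmul_eq_mul]
  refine Finset.sum_eq_card_nsmul fun V hV => ?_
  rw [natCard_span_range_eq, (Finset.mem_filter.1 hV).2.1]

end SpanningFamilies

/-- All fibres have the size of the kernel, so a surjective homomorphism carries the uniform
distribution to the uniform one. -/
theorem natCard_subtype_comp_mul_natCard {G H : Type*} [AddGroup G] [AddGroup H] [Finite G]
    [Finite H] (f : G →+ H) (hf : Function.Surjective f) (P : H → Prop) :
    Nat.card {g // P (f g)} * Nat.card H = Nat.card {h // P h} * Nat.card G := by
  classical
  let _ := Fintype.ofFinite G
  let _ := Fintype.ofFinite H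
  have key : ∀ Q : H → Prop, Nat.card {g // Q (f g)} =
      Nat.card {h // Q h} * (Finset.univ.filter fun g => f g = 0).card := by
    intro Q
    simp only [Nat.card_eq_fintype_card, Fintype.card_subtype]
    rw [Finset.card_eq_sum_card_fiberwise (t := {h | Q h}) (f := f) (fun g hg => by simpa using hg),
      ← smul_eq_mul]
    refine Finset.sum_eq_card_nsmul fun h hh => ?_
    rw [← AddMonoidHom.card_fiber_eq_of_mem_range f (hf h) (hf 0)]
    congr 1
    ext g
    simp only [Finset.mem_filter, Finset.mem_univ, true_and] at hh ⊢
    exact ⟨fun h => h.2, fun h => ⟨h ▸ hh, h⟩⟩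
  have h1 := key P
  have h2 := key fun _ => True
  rw [Nat.card_congr (Equiv.subtypeUnivEquiv fun _ => trivial),
    Nat.card_congr (Equiv.subtypeUnivEquiv fun _ => trivial)] at h2
  rw [h1, h2]
  ring

/-! ### Recovery from a fixed set of received packets -/

section Received

variable {F : Type*} [Field F] {k m : ℕ}

/-- The rows of the received source packets are killed by the projection. -/
theorem map_deleteCoords_rowSpace_received (C : Matrix (Fin m) (Fin k) F) (H : Finset (Fin k))
    (T : Finset (Fin m)) :
    (rowSpace (received C (H.disjSum T))).map (deleteCoords F H) =
      Submodule.span F (Set.range fun t : T => deleteCoords F H (C t)) := by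
  rw [rowSpace, Submodule.map_span, ← Set.range_comp]
  apply le_antisymm
  · rw [Submodule.span_le]
    rintro _ ⟨⟨p, hp⟩, rfl⟩
    rcases p with i | t
    · have hi : i ∈ H := Finset.inl_mem_disjSum.1 hp
      have h0 : deleteCoords F H ((1 : Matrix (Fin k) (Fin k) F) i) = 0 := by
        rw [← LinearMap.mem_ker, mem_ker_deleteCoords]
        intro j hj
        exact Matrix.one_apply_ne (by rintro rfl; exact hj hi)
      have : (deleteCoords F H ∘ (received C (H.disjSum T)).row) ⟨Sum.inl i, hp⟩ = 0 := h0
      rw [this]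
      exact Submodule.zero_mem _
    · exact Submodule.subset_span ⟨⟨t, Finset.inr_mem_disjSum.1 hp⟩, rfl⟩
  · rw [Submodule.span_le]
    rintro _ ⟨t, rfl⟩
    exact Submodule.subset_span ⟨⟨Sum.inr t, Finset.inr_mem_disjSum.2 t.2⟩, rfl⟩

theorem recoverable_eq_unitIndices {ι : Type*} (M : Matrix ι (Fin k) F) :
    recoverable M = unitIndices (rowSpace M) := rfl

theorem ncard_recoverable_received (C : Matrix (Fin m) (Fin k) F) (H : Finset (Fin k))
    (T : Finset (Fin m)) :
    (recoverable (received C (H.disjSum T))).ncard = H.card +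
      (unitIndices (Submodule.span F
        (Set.range fun t : T => deleteCoords F H (C t)))).ncard := by
  rw [recoverable_eq_unitIndices, ← map_deleteCoords_rowSpace_received]
  refine ncard_unitIndices_eq_add fun i hi => ?_
  refine Submodule.subset_span ⟨⟨Sum.inl i, Finset.inl_mem_disjSum.2 hi⟩, ?_⟩
  ext j
  simp only [Matrix.row, received, transmitted, Matrix.submatrix_apply, Matrix.fromRows_apply_inl,
    id, Matrix.one_apply, Pi.single_apply, eq_comm]

/-- The restriction of a matrix to the rows in `T` and the columns outside `H`. -/
def restrictEntries (F : Type*) [Field F] (H : Finset (Fin k)) (T : Finset (Fin m)) :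
    Matrix (Fin m) (Fin k) F →+ (T → {i // i ∉ H} → F) where
  toFun C t := deleteCoords F H (C t)
  map_zero' := funext fun _ => map_zero _
  map_add' C D := funext fun t => map_add (deleteCoords F H) (C t) (D t)

theorem restrictEntries_surjective (H : Finset (Fin k)) (T : Finset (Fin m)) :
    Function.Surjective (restrictEntries F H T) := by
  intro D
  choose g hg using fun t => deleteCoords_surjective H (D t)
  classical
  refine ⟨fun t => if ht : t ∈ T then g ⟨t, ht⟩ else 0, funext fun t => ?_⟩
  simp only [restrictEntries, AddMonoidHom.coe_mk, ZeroHom.coe_mk, dif_pos t.2, hg]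

theorem natCard_le_ncard_recoverable_received [Fintype F] (H : Finset (Fin k))
    (T : Finset (Fin m)) (x : ℕ) :
    (Nat.card {C : Matrix (Fin m) (Fin k) F //
        x ≤ (recoverable (received C (H.disjSum T))).ncard} : ℝ) /
        (Fintype.card F : ℝ) ^ (m * k) =
      ((Fintype.card F : ℝ) ^ (T.card * (k - H.card)))⁻¹ *
        ∑ s ∈ Finset.range (k - H.card + 1),
          (∏ l ∈ Finset.range s,
            ((Fintype.card F : ℝ) ^ T.card - (Fintype.card F : ℝ) ^ l)) *
          ∑ i ∈ Finset.Icc (x - H.card) s, ((k - H.card).choose i : ℝ) *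
            ∑ j ∈ Finset.range (k - H.card - i + 1),
              (-1 : ℝ) ^ j * ((k - H.card - i).choose j : ℝ) *
                (gaussBinom F (k - H.card - i - j) ((s : ℤ) - i - j) : ℝ) := by
  classical
  have hc : Fintype.card {i // i ∉ H} = k - H.card := by
    rw [Fintype.card_subtype_compl (fun i => i ∈ H), Fintype.card_coe, Fintype.card_fin]
  have h1 := natCard_le_ncard_unitIndices_span_range (F := F) (α := T) (ι := {i // i ∉ H})
    (x - H.card)
  rw [hc, Fintype.card_coe] at h1
  rw [← h1]
  have h2 := natCard_subtype_comp_mul_natCard (restrictEntries F H T)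
    (restrictEntries_surjective H T)
    (fun D => x - H.card ≤ (unitIndices (Submodule.span F (Set.range D))).ncard)
  have h3 : Nat.card (T → {i // i ∉ H} → F) = Fintype.card F ^ (T.card * (k - H.card)) := by
    simp only [Nat.card_eq_fintype_card, Fintype.card_fun, hc, Fintype.card_coe]
    rw [← pow_mul, mul_comm]
  have h4 : Nat.card (Matrix (Fin m) (Fin k) F) = Fintype.card F ^ (m * k) := by
    change Nat.card (Fin m → Fin k → F) = _
    simp only [Nat.card_eq_fintype_card, Fintype.card_fun, Fintype.card_fin]
    rw [← pow_mul, mul_comm]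
  have h5 : Nat.card {C : Matrix (Fin m) (Fin k) F //
        x ≤ (recoverable (received C (H.disjSum T))).ncard} =
      Nat.card {C : Matrix (Fin m) (Fin k) F //
        x - H.card ≤ (unitIndices (Submodule.span F (Set.range (restrictEntries F H T C)))).ncard} := by
    refine Nat.card_congr (Equiv.subtypeEquivRight fun C => ?_)
    -- Truncated subtraction also covers `|H| > x`, where the condition is void.
    rw [ncard_recoverable_received, tsub_le_iff_left]
    rfl
  rw [h3, h4, ← h5] at h2
  have h6 : (Fintype.card F : ℝ) ≠ 0 := Nat.cast_ne_zero.2 Fintype.card_ne_zero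
  rw [div_eq_iff (pow_ne_zero _ h6), mul_assoc, eq_inv_mul_iff_mul_eq₀ (pow_ne_zero _ h6), mul_comm]
  exact_mod_cast h2

end Received

/-! ### Averaging over received sets and reindexing -/

section Averages

theorem cond_real_eq_average {Ω α β : Type*} [mΩ : MeasurableSpace Ω] (μ : Measure Ω)
    [IsProbabilityMeasure μ] [Fintype α] (C : Ω → α) (S : Ω → β)
    (hCmeas : Measurable[mΩ, ⊤] C) (hSmeas : Measurable[mΩ, ⊤] S) (u : ℝ)
    (hC : ∀ a, μ.real {ω | C ω = a} = u) (hCS : @IndepFun Ω _ _ mΩ ⊤ ⊤ C S μ)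
    (B : Finset β) (hB : μ {ω | S ω ∈ B} ≠ 0)
    (hS : ∀ b ∈ B, ∀ b' ∈ B, μ.real {ω | S ω = b} = μ.real {ω | S ω = b'})
    (P : α → β → Prop) :
    (cond μ {ω | S ω ∈ B}).real {ω | P (C ω) (S ω)} =
      1 / (B.card : ℝ) * ∑ b ∈ B, (Nat.card {a // P a b} : ℝ) * u := by
  classical
  have hCs : ∀ s : Set α, MeasurableSet (C ⁻¹' s) := fun s => hCmeas trivial
  have hSs : ∀ s : Set β, MeasurableSet (S ⁻¹' s) := fun s => hSmeas trivial
  have hBsum : μ.real {ω | S ω ∈ B} = ∑ b ∈ B, μ.real {ω | S ω = b} := by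
    rw [← measureReal_biUnion_finset]
    · congr 1
      ext ω
      simp
    · intro b _ b' _ hbb
      exact Set.disjoint_left.2 fun ω h h' => hbb (h.symm.trans h')
    · exact fun b _ => hSs {b}
  have hB0 : μ.real {ω | S ω ∈ B} ≠ 0 := (measureReal_ne_zero_iff (measure_ne_top μ _)).2 hB
  obtain ⟨b₀, hb₀⟩ : B.Nonempty := by
    rw [Finset.nonempty_iff_ne_empty]
    rintro rfl
    simp at hB
  set p := μ.real {ω | S ω = b₀} with hp
  have hBp : μ.real {ω | S ω ∈ B} = B.card * p := by
    rw [hBsum, ← nsmul_eq_mul]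
    exact Finset.sum_eq_card_nsmul fun b hb => hS b hb b₀ hb₀
  have hjoint : μ.real ({ω | S ω ∈ B} ∩ {ω | P (C ω) (S ω)}) =
      ∑ b ∈ B, (Nat.card {a // P a b} : ℝ) * u * p := by
    have hset : {ω | S ω ∈ B} ∩ {ω | P (C ω) (S ω)} =
        ⋃ b ∈ B, (C ⁻¹' {a | P a b} ∩ S ⁻¹' {b}) := by
      ext ω
      simp
      tauto
    rw [hset, measureReal_biUnion_finset]
    · refine Finset.sum_congr rfl fun b hb => ?_
      have hind := hCS.measure_inter_preimage_eq_mul {a | P a b} {b} trivial trivial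
      rw [measureReal_def, hind, ENNReal.toReal_mul]
      have h1 : μ.real (C ⁻¹' {a | P a b}) = (Nat.card {a // P a b} : ℝ) * u := by
        have h2 : C ⁻¹' {a | P a b} = ⋃ a ∈ Finset.univ.filter fun a => P a b, {ω | C ω = a} := by
          ext ω
          simp
        rw [h2, measureReal_biUnion_finset]
        · rw [Nat.card_eq_fintype_card, Fintype.card_subtype, ← nsmul_eq_mul]
          exact Finset.sum_eq_card_nsmul fun a _ => hC a
        · intro a _ a' _ haa
          exact Set.disjoint_left.2 fun ω h h' => haa (h.symm.trans h')
        · exact fun a _ => hCs {a}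
      exact congrArg₂ (· * ·) h1 (hS b hb b₀ hb₀)
    · intro b _ b' _ hbb
      exact Set.disjoint_left.2 fun ω h h' => hbb (h.2.symm.trans h'.2)
    · exact fun b _ => (hCs _).inter (hSs _)
  have hms : MeasurableSet {ω | S ω ∈ B} := hSs (B : Set β)
  rw [measureReal_def, cond_apply hms, ENNReal.toReal_mul, ENNReal.toReal_inv]
  change (μ.real {ω | S ω ∈ B})⁻¹ * μ.real ({ω | S ω ∈ B} ∩ {ω | P (C ω) (S ω)}) = _
  rw [hBp] at hB0
  -- The conditioning event has probability `|B| * p`, so `p` is nonzero and cancels.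
  have hp0 : p ≠ 0 := right_ne_zero_of_mul hB0
  rw [hjoint, hBp, ← Finset.sum_mul]
  generalize ∑ b ∈ B, (Nat.card {a // P a b} : ℝ) * u = t
  field_simp

theorem sum_finset_sum_card_eq {M : Type*} [AddCommMonoid M] {k m n : ℕ} (g : ℕ → ℕ → M) :
    ∑ A : Finset (Fin k ⊕ Fin m) with A.card = n, g A.toLeft.card A.toRight.card =
      ∑ h ∈ Finset.range (n + 1), (k.choose h * m.choose (n - h)) • g h (n - h) := by
  rw [← Finset.sum_fiberwise_of_maps_to (t := Finset.range (n + 1))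
    (g := fun A : Finset (Fin k ⊕ Fin m) => A.toLeft.card)]
  · refine Finset.sum_congr rfl fun h hh => ?_
    rw [Finset.mem_range_succ_iff] at hh
    have hcard : (Finset.univ.filter fun A : Finset (Fin k ⊕ Fin m) =>
        A.card = n ∧ A.toLeft.card = h).card = k.choose h * m.choose (n - h) := by
      calc _ = (Finset.powersetCard h (Finset.univ : Finset (Fin k)) ×ˢ
              Finset.powersetCard (n - h) (Finset.univ : Finset (Fin m))).card := by
            refine Finset.card_equiv Finset.sumEquiv.toEquiv fun A => ?_
            have := A.card_toLeft_add_card_toRight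
            simp only [Finset.mem_filter, Finset.mem_univ, true_and, Finset.mem_product,
              Finset.mem_powersetCard, Finset.subset_univ]
            change _ ↔ A.toLeft.card = h ∧ A.toRight.card = n - h
            omega
        _ = _ := by simp
    rw [Finset.filter_filter, ← hcard]
    refine Finset.sum_eq_card_nsmul fun A hA => ?_
    have := A.card_toLeft_add_card_toRight
    obtain ⟨-, h1, h2⟩ := Finset.mem_filter.1 hA
    rw [h2, show A.toRight.card = n - h by omega]
  · intro A hA
    have := A.card_toLeft_add_card_toRight
    have := (Finset.mem_filter.1 hA).2
    rw [Finset.mem_range_succ_iff]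
    omega

/-- Substitution `r = h + s`; the hypotheses make `f` vanish at the index pairs that the right-hand
side omits. -/
theorem sum_range_sum_range_eq_sum_Icc {M : Type*} [AddCommMonoid M] {k n x a : ℕ} (f : ℕ → ℕ → M)
    (h₁ : ∀ h s, h ≤ n → n < h + s → f h s = 0) (h₂ : ∀ h s, h + s < x → f h s = 0)
    (h₃ : ∀ h s, h < a → f h s = 0) (h₄ : ∀ h s, k < h → f h s = 0) :
    ∑ h ∈ Finset.range (n + 1), ∑ s ∈ Finset.range (k - h + 1), f h s =
      ∑ r ∈ Finset.Icc x (min n k), ∑ h ∈ Finset.Icc a r, f h (r - h) := by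
  rw [Finset.sum_sigma', Finset.sum_sigma']
  symm
  refine Finset.sum_of_injOn (fun p => ⟨p.2, p.1 - p.2⟩) ?_ ?_ ?_ ?_
  · rintro ⟨r, h⟩ hp ⟨r', h'⟩ hp' heq
    simp only [Finset.coe_sigma, Set.mem_sigma_iff, Finset.mem_coe, Finset.mem_Icc] at hp hp'
    simp only [Sigma.mk.injEq, heq_eq_eq] at heq ⊢
    omega
  · rintro ⟨r, h⟩ hp
    simp only [Finset.coe_sigma, Set.mem_sigma_iff, Finset.mem_coe, Finset.mem_Icc,
      Finset.mem_range] at hp ⊢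
    omega
  · rintro ⟨h, s⟩ hp hnot
    simp only [Finset.mem_sigma, Finset.mem_range] at hp
    by_contra hne
    have a1 : ¬ n < h + s := fun hh => hne (h₁ h s (by omega) hh)
    have a2 : ¬ h + s < x := fun hh => hne (h₂ h s hh)
    have a3 : ¬ h < a := fun hh => hne (h₃ h s hh)
    have a4 : ¬ k < h := fun hh => hne (h₄ h s hh)
    refine hnot ⟨⟨h + s, h⟩, ?_, ?_⟩
    · simp only [Finset.coe_sigma, Set.mem_sigma_iff, Finset.mem_coe, Finset.mem_Icc]
      omega
    · simp
  · rintro ⟨r, h⟩ _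
    rfl

end Averages

/-- `C` is the random matrix of coding vectors of the `nT - k` coded packets and `S` the random
set of received packets. In the formula, `n + k - nT` and `x - h` are truncated differences, that
is, `max (0, n - nT + k)` and `max (0, x - h)`; all other natural-number differences are
non-negative. -/
theorem proposition2 {F : Type*} [Field F] [Fintype F]
    (k nT n x : ℕ) (hk : k ≤ nT) (hn : n ≤ nT) (hx : x ≤ k)
    {Ω : Type*} [mΩ : MeasurableSpace Ω] (μ : Measure Ω) [IsProbabilityMeasure μ]
    (C : Ω → Matrix (Fin (nT - k)) (Fin k) F)
    (S : Ω → Finset (Fin k ⊕ Fin (nT - k)))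
    (hCmeas : Measurable[mΩ, ⊤] C) (hSmeas : Measurable[mΩ, ⊤] S)
    -- the coding coefficients are independent and uniformly distributed on `F`
    (hC : ∀ c : Matrix (Fin (nT - k)) (Fin k) F,
      μ.real {ω | C ω = c} = 1 / (Fintype.card F : ℝ) ^ ((nT - k) * k))
    -- reception is independent of the coding coefficients
    (hCS : @IndepFun Ω _ _ mΩ ⊤ ⊤ C S μ)
    -- `n` packets are received with positive probability, and then all sets of `n` transmitted
    -- packets are equally likely to be the received ones
    (hN : μ {ω | (S ω).card = n} ≠ 0)
    (hS : ∀ A B : Finset (Fin k ⊕ Fin (nT - k)), A.card = n → B.card = n →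
      μ.real {ω | S ω = A} = μ.real {ω | S ω = B}) :
    (cond μ {ω | (S ω).card = n}).real {ω | x ≤ (recoverable (received (C ω) (S ω))).ncard} =
      1 / (nT.choose n : ℝ) *
        ∑ r ∈ Finset.Icc x (min n k), ∑ h ∈ Finset.Icc (n + k - nT) r,
          ((k.choose h : ℝ) * ((nT - k).choose (n - h) : ℝ) *
            ((Fintype.card F : ℝ) ^ ((n - h) * (k - h)))⁻¹ *
            (∏ l ∈ Finset.range (r - h),
              ((Fintype.card F : ℝ) ^ (n - h) - (Fintype.card F : ℝ) ^ l)) *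
            ∑ i ∈ Finset.Icc (x - h) (r - h), ((k - h).choose i : ℝ) *
              ∑ j ∈ Finset.range (k - h - i + 1), (-1 : ℝ) ^ j * ((k - h - i).choose j : ℝ) *
                (gaussBinom F (k - h - i - j) ((r : ℤ) - h - i - j) : ℝ)) := by
  classical
  have hset : {ω | (S ω).card = n} =
      {ω | S ω ∈ Finset.univ.filter fun A : Finset (Fin k ⊕ Fin (nT - k)) => A.card = n} := by
    ext ω
    simp
  have hcardB : (Finset.univ.filter fun A : Finset (Fin k ⊕ Fin (nT - k)) => A.card = n).card =
      nT.choose n := by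
    rw [show (Finset.univ.filter fun A : Finset (Fin k ⊕ Fin (nT - k)) => A.card = n) =
        Finset.powersetCard n Finset.univ by ext A; simp [Finset.mem_powersetCard],
      Finset.card_powersetCard, Finset.card_univ, Fintype.card_sum, Fintype.card_fin,
      Fintype.card_fin, Nat.add_sub_cancel' hk]
  rw [hset] at hN ⊢
  rw [cond_real_eq_average μ C S hCmeas hSmeas _ hC hCS _ hN (fun A hA B hB => hS A B
      (Finset.mem_filter.1 hA).2 (Finset.mem_filter.1 hB).2)
      (fun c A => x ≤ (recoverable (received c A)).ncard), hcardB]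
  congr 1
  -- Contribution of row spaces of dimension `s` after deletion, with `h` source and `a` coded
  -- packets received.
  let w : ℕ → ℕ → ℕ → ℝ := fun h a s =>
    ((Fintype.card F : ℝ) ^ (a * (k - h)))⁻¹ *
      ((∏ l ∈ Finset.range s, ((Fintype.card F : ℝ) ^ a - (Fintype.card F : ℝ) ^ l)) *
        ∑ i ∈ Finset.Icc (x - h) s, ((k - h).choose i : ℝ) *
          ∑ j ∈ Finset.range (k - h - i + 1), (-1 : ℝ) ^ j * ((k - h - i).choose j : ℝ) *
            (gaussBinom F (k - h - i - j) ((s : ℤ) - i - j) : ℝ))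
  calc _ = ∑ A : Finset (Fin k ⊕ Fin (nT - k)) with A.card = n,
        ∑ s ∈ Finset.range (k - A.toLeft.card + 1), w A.toLeft.card A.toRight.card s := by
        refine Finset.sum_congr rfl fun A _ => ?_
        rw [mul_one_div, ← Finset.mul_sum, ← natCard_le_ncard_recoverable_received,
          Finset.toLeft_disjSum_toRight]
    _ = ∑ h ∈ Finset.range (n + 1), ∑ s ∈ Finset.range (k - h + 1),
          (k.choose h * (nT - k).choose (n - h) : ℝ) * w h (n - h) s := by
        rw [sum_finset_sum_card_eq fun h a => ∑ s ∈ Finset.range (k - h + 1), w h a s]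
        refine Finset.sum_congr rfl fun h _ => ?_
        rw [nsmul_eq_mul, Finset.mul_sum]
        push_cast
        rfl
    _ = ∑ r ∈ Finset.Icc x (min n k), ∑ h ∈ Finset.Icc (n + k - nT) r,
          (k.choose h * (nT - k).choose (n - h) : ℝ) * w h (n - h) (r - h) := by
        refine sum_range_sum_range_eq_sum_Icc _ (fun h s hh hs => ?_) (fun h s hs => ?_)
          (fun h s hh => ?_) (fun h s hh => ?_)
        -- The rank `s` exceeds the number `n - h` of coded packets: the factor at `l = n - h` is
        -- zero.
        · simp only [w]
          rw [Finset.prod_eq_zero (Finset.mem_range.2 (show n - h < s by omega)) (sub_self _)]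
          ring
        · simp only [w]
          rw [Finset.Icc_eq_empty (by omega), Finset.sum_empty]
          ring
        -- Fewer than `n - h` coded packets were transmitted.
        · rw [Nat.choose_eq_zero_of_lt (show nT - k < n - h by omega)]
          simp
        · rw [Nat.choose_eq_zero_of_lt hh]
          simp
    _ = _ := by
        refine Finset.sum_congr rfl fun r _ => Finset.sum_congr rfl fun h hh => ?_
        simp only [w, Nat.cast_sub (Finset.mem_Icc.1 hh).2]
        ring
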